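/- Let $\mathbb{L}^5=\mathbb{R}\times\mathbb{R}^4$ carry the Lorentz form $\mathcal{L}(u,v)=-u_0v_0+u_1v_1+\dots+u_4v_4$, let $\Lambda^4=\{\mathcal{L}(\sigma,\sigma)=1\}$, and identify $\mathbf{S}^3$ with the section $\{x_0=1\}$ of the light cone; $\sigma\in\Lambda^4$ represents the sphere $\sigma^\perp\cap \mathbf{S}^3$. Let $M$ be a smooth immersed surface in $\mathbf{S}^3$ with unit normal field $n$ (tangent to $\mathbf{S}^3$). The spheres tangent to $M$ at $m$ are $\sigma=km+n$, $k\in\mathbb{R}$. The contact is a saddle contact if the Hessian $II-kI$ at $m$ of the function $\mathcal{L}(\sigma,\cdot)|_M$ is indefinite, and the sphere is osculating if $k$ is a principal curvature. $V(M)$ is the set of the tangent spheres with saddle contact and of the osculating spheres; its tangent space at $km+n$ is the image of the differential of $(m,k)\mapsto km+n$. Let $C$ be a smooth curve on $M$, defined on an open interval and parametrized by arc length, with unit tangent $T$. Let $N_1$ be a unit field along $C$ tangent to $M$ and orthogonal to $T$ (either choice of sign), and let $k_n,k_g,\tau_g$ be the normal curvature, the geodesic curvature and the geodesic torsion ($\langle\nabla_T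 n,N_1\rangle=-\tau_g$) of $C$. An osculating sphere of $C$ at a point is a sphere having contact of order at least $3$ with $C$ there, and $C$ is a Darboux curve if at each of its points an osculating sphere of $C$ is tangent to $M$. The canonical section $\mathrm{Cansec}(C)$ is the curve $\sigma=km+n$ of spheres tangent to $M$ along $C$ such that, wherever $C$ is not tangent to a principal direction, one branch of the intersection of the sphere with $M$ is tangent to $C$, and, wherever $C$ is tangent to a principal direction, $\sigma$ is the osculating sphere of $M$ for that direction. **Theorem.** (i) $C$ is a Darboux curve if and only if $k_n'+\tau_g k_g=0$ along $C$. (ii) Suppose that the parameters at which $C$ is not tangent to a principal direction are dense (in particular, this holds if $C$ is nowhere tangent to a principal direction). Then the following are equivalent: $C$ is a Darboux curve; $\mathrm{Cansec}(C)$ is a geodesic of $V(M)$; $k_n'+\tau_gk_g=0$ along $C$. Here "geodesic of $V(M)$" means that, at all parameters where $C$ is not tangent to a principal direction (all parameters, if there is no such tangency), $\mathrm{Cansec}(C)$ lies in $V(M)$, is space-like, and its geodesic curvature vector in $\Lambda^4$ (the component tangent to $\Lambda^4$ of its second derivative with respect to Lorentz arc length) is $\mathcal{L}$-orthogonal to the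 tangent space of $V(M)$. -/

import Mathlib

open scoped Manifold ContDiff Topology

noncomputable section

namespace DarbouxCurves

/-- The Euclidean space `ℝ⁴` containing the unit sphere `S³`. -/
abbrev E4 : Type := EuclideanSpace ℝ (Fin 4)

/-- The Lorentz space `𝕃⁵ = ℝ × ℝ⁴`; the first factor is the time coordinate `x₀`. -/
abbrev L5 : Type := ℝ × E4

/-- The Lorentz bilinear form `-u₀ v₀ + (u₁ v₁ + ⋯ + u₄ v₄)`. -/
def lorentz (u v : L5) : ℝ := -(u.1 * v.1) + inner ℝ u.2 v.2

/-- The Lorentz quadric `Λ⁴`. -/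
def Lambda : Set L5 := {σ | lorentz σ σ = 1}

/-- The inclusion of `S³` in the light cone, as the section `{x₀ = 1}`. -/
def light (x : E4) : L5 := (1, x)

/-- The sphere `σ^⊥ ∩ S³` of `S³` corresponding to `σ ∈ Λ⁴`. -/
def sphereOf (σ : L5) : Set E4 := {x | ‖x‖ = 1 ∧ lorentz σ (light x) = 0}

/-- An immersed smooth surface in `S³` with a choice `n` of unit normal
(tangent to `S³`, normal to the surface). -/
structure Surface (M : Type*) [TopologicalSpace M]
    [ChartedSpace (EuclideanSpace ℝ (Fin 2)) M] [IsManifold (𝓡 2) ∞ M] where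
  pos : M → E4
  n : M → E4
  smooth_pos : ContMDiff (𝓡 2) 𝓘(ℝ, E4) ∞ pos
  smooth_n : ContMDiff (𝓡 2) 𝓘(ℝ, E4) ∞ n
  norm_pos : ∀ p, ‖pos p‖ = 1
  immersion : ∀ p, Function.Injective (mfderiv (𝓡 2) 𝓘(ℝ, E4) pos p)
  norm_n : ∀ p, ‖n p‖ = 1
  n_tangent_sphere : ∀ p, inner ℝ (pos p) (n p) = 0
  n_normal : ∀ p (v : TangentSpace (𝓡 2) p),
    inner ℝ (n p) ((mfderiv (𝓡 2) 𝓘(ℝ, E4) pos p v : E4)) = 0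

namespace Surface

variable {M : Type*} [TopologicalSpace M]
  [ChartedSpace (EuclideanSpace ℝ (Fin 2)) M] [IsManifold (𝓡 2) ∞ M]

/-- The differential of the immersion at `p`. -/
def dpos (S : Surface M) (p : M) : TangentSpace (𝓡 2) p →L[ℝ] E4 :=
  mfderiv (𝓡 2) 𝓘(ℝ, E4) S.pos p

/-- The differential of the unit normal at `p`. -/
def dn (S : Surface M) (p : M) : TangentSpace (𝓡 2) p →L[ℝ] E4 :=
  mfderiv (𝓡 2) 𝓘(ℝ, E4) S.n p

/-- The first fundamental form, on the diagonal. -/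
def firstForm (S : Surface M) (p : M) (v : TangentSpace (𝓡 2) p) : ℝ :=
  inner ℝ (S.dpos p v) (S.dpos p v)

/-- The second fundamental form with respect to `n`, on the diagonal. -/
def secondForm (S : Surface M) (p : M) (v : TangentSpace (𝓡 2) p) : ℝ :=
  -inner ℝ (S.dn p v) (S.dpos p v)

/-- `v` is a principal vector at `p`, with principal curvature `κ`. -/
def PrincipalWith (S : Surface M) (p : M) (v : TangentSpace (𝓡 2) p) (κ : ℝ) : Prop :=
  v ≠ 0 ∧ S.dn p v = -κ • S.dpos p v

/-- The sphere tangent to `M` at `p`, with normal `n` and curvature `k`: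
`σ = k m + n ∈ Λ⁴`, where `m` is the point of the light cone over `p`. -/
def tangentSphere (S : Surface M) (q : M × ℝ) : L5 :=
  q.2 • light (S.pos q.1) + ((0 : ℝ), S.n q.1)

/-- The sphere `k m + n` has a saddle contact with `M` at `p`: the function
`x ↦ 𝓛(k m + n, (1, x))` on `M`, which defines the intersection of the sphere with `M` and
whose Hessian at its critical point `p` is `II - k I`, has a non-degenerate saddle at `p`. -/
def SaddleContact (S : Surface M) (p : M) (k : ℝ) : Prop :=
  ∃ v w : TangentSpace (𝓡 2) p,
    S.secondForm p v - k * S.firstForm p v < 0 ∧ 0 < S.secondForm p w - k * S.firstForm p w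

/-- The sphere `k m + n` is osculating `M` at `p`: `k` is a principal curvature. -/
def OsculatesSurface (S : Surface M) (p : M) (k : ℝ) : Prop :=
  ∃ v : TangentSpace (𝓡 2) p, S.PrincipalWith p v k

/-- `V(M)`: the tangent spheres with saddle contact and the osculating spheres. A point `(p, k)`
stands for the sphere `k m + n ∈ Λ⁴`; the map `tangentSphere` into `Λ⁴` is an immersion at the
spheres with saddle contact. -/
def V (S : Surface M) : Set (M × ℝ) :=
  {q | S.SaddleContact q.1 q.2 ∨ S.OsculatesSurface q.1 q.2}

/-- The tangent space of `V(M)` in `𝕃⁵` at the sphere `q = (p, k)`: the image of the differential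
of `(p, k) ↦ k m + n`, whose value in the direction `(v, κ)` is `κ m + k dm(v) + dn(v)`. -/
def tangentV (S : Surface M) (q : M × ℝ) : Set L5 :=
  {w | ∃ (v : TangentSpace (𝓡 2) q.1) (κ : ℝ),
    w = κ • light (S.pos q.1) + q.2 • ((0 : ℝ), S.dpos q.1 v) + ((0 : ℝ), S.dn q.1 v)}

/-- The velocity of a curve on `M`. -/
def velocity (c : ℝ → M) (s : ℝ) : TangentSpace (𝓡 2) (c s) :=
  mfderiv 𝓘(ℝ, ℝ) (𝓡 2) c s (1 : ℝ)

/-- `c` is a smooth curve on `M` over the parameter set `I`, parametrized by arc length. -/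
def IsUnitSpeed (S : Surface M) (c : ℝ → M) (I : Set ℝ) : Prop :=
  ContMDiffOn 𝓘(ℝ, ℝ) (𝓡 2) ∞ c I ∧ ∀ s ∈ I, ‖deriv (S.pos ∘ c) s‖ = 1

/-- The parameters in `I` where `c` is not tangent to a principal direction. -/
def nonPrincipal (S : Surface M) (c : ℝ → M) (I : Set ℝ) : Set ℝ :=
  {s | s ∈ I ∧ ¬ ∃ κ, S.PrincipalWith (c s) (velocity c s) κ}

/-- `N₁` is a field of unit vectors along `c`, tangent to `M` and normal to `c`. -/
def IsUnitConormal (S : Surface M) (c : ℝ → M) (I : Set ℝ) (N₁ : ℝ → E4) : Prop :=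
  ∀ s ∈ I, ‖N₁ s‖ = 1 ∧ N₁ s ∈ Set.range (S.dpos (c s)) ∧
    inner ℝ (deriv (S.pos ∘ c) s) (N₁ s) = 0

/-- Normal curvature of a curve parametrized by arc length. -/
def normalCurv (S : Surface M) (c : ℝ → M) (s : ℝ) : ℝ :=
  inner ℝ (deriv (deriv (S.pos ∘ c)) s) (S.n (c s))

/-- Geodesic curvature of a curve parametrized by arc length. -/
def geodCurv (S : Surface M) (c : ℝ → M) (N₁ : ℝ → E4) (s : ℝ) : ℝ :=
  inner ℝ (deriv (deriv (S.pos ∘ c)) s) (N₁ s)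

/-- Geodesic torsion of a curve parametrized by arc length: `⟨∇_T n, N₁⟩ = -τ_g`. -/
def geodTorsion (S : Surface M) (c : ℝ → M) (N₁ : ℝ → E4) (s : ℝ) : ℝ :=
  -inner ℝ (deriv (S.n ∘ c) s) (N₁ s)

end Surface

/-- The curve `γ` in `S³` has contact of order at least `r` at `γ s` with the sphere given by `σ`:
the defining function of the sphere vanishes along `γ` to order more than `r` at `s`. -/
def HasContact (γ : ℝ → E4) (s : ℝ) (σ : L5) (r : ℕ) : Prop :=
  ∀ j ≤ r, iteratedDeriv j (fun t => lorentz σ (light (γ t))) s = 0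

/-- `σ ∈ Λ⁴` is an osculating sphere of the curve `γ` at `γ s`: contact of order at least `3`. -/
def IsOsculatingSphere (γ : ℝ → E4) (s : ℝ) (σ : L5) : Prop :=
  σ ∈ Lambda ∧ HasContact γ s σ 3

namespace Surface

variable {M : Type*} [TopologicalSpace M]
  [ChartedSpace (EuclideanSpace ℝ (Fin 2)) M] [IsManifold (𝓡 2) ∞ M]

/-- The sphere given by `σ` passes through the point `p` of `M` and is tangent to `M` there. -/
def IsTangentAt (S : Surface M) (p : M) (σ : L5) : Prop :=
  S.pos p ∈ sphereOf σ ∧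
    ∀ v : TangentSpace (𝓡 2) p, lorentz σ ((0 : ℝ), S.dpos p v) = 0

/-- Darboux curve: at each of its points, an osculating sphere of the curve is tangent to `M`.
(The osculating sphere is unique except at the vertices of the curve.) -/
def IsDarboux (S : Surface M) (c : ℝ → M) (I : Set ℝ) : Prop :=
  ∀ s ∈ I, ∃ σ, IsOsculatingSphere (S.pos ∘ c) s σ ∧ S.IsTangentAt (c s) σ

/-- One branch of the intersection of `M` with the sphere `σ` is tangent to the curve `c` at
`c s`: some smooth regular curve `β` of `M` through `c s` stays in the sphere and is tangent
to `c`. -/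
def BranchTangent (S : Surface M) (c : ℝ → M) (s : ℝ) (σ : L5) : Prop :=
  ∃ β : ℝ → M, β 0 = c s ∧ ContMDiffAt 𝓘(ℝ, ℝ) (𝓡 2) ∞ β 0 ∧
    (∃ a : ℝ, a ≠ 0 ∧ deriv (S.pos ∘ β) 0 = a • deriv (S.pos ∘ c) s) ∧
    ∀ᶠ t in 𝓝 (0 : ℝ), S.pos (β t) ∈ sphereOf σ

/-- The curve `s ↦ k(s) m(s) + n(s)` of tangent spheres is the canonical section `Cansec(C)`:
one branch of the intersection of the sphere with `M` is tangent to `C` where `C` is not tangent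
to a principal direction, and elsewhere it is the osculating sphere of `M` corresponding to the
principal direction of `C`. -/
def IsCansec (S : Surface M) (c : ℝ → M) (I : Set ℝ) (k : ℝ → ℝ) : Prop :=
  ∀ s ∈ I,
    (s ∈ S.nonPrincipal c I → S.BranchTangent c s (S.tangentSphere (c s, k s))) ∧
    (s ∉ S.nonPrincipal c I → S.PrincipalWith (c s) (velocity c s) (k s))

end Surface

/-- The Lorentz speed of a curve of `𝕃⁵`. -/
def lorentzSpeed (σ : ℝ → L5) (s : ℝ) : ℝ := Real.sqrt (lorentz (deriv σ s) (deriv σ s))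

/-- Derivative, along the space-like curve `σ`, with respect to the Lorentz arc length of `σ`. -/
def arcDeriv (σ f : ℝ → L5) (s : ℝ) : L5 := (lorentzSpeed σ s)⁻¹ • deriv f s

/-- The geodesic curvature vector of a space-like curve of `Λ⁴`: the component tangent to `Λ⁴` of
its acceleration with respect to arc length. -/
def geodCurvVector (σ : ℝ → L5) (s : ℝ) : L5 :=
  arcDeriv σ (arcDeriv σ σ) s - lorentz (arcDeriv σ (arcDeriv σ σ) s) (σ s) • σ s

/-- Over the parameter set `J`, the curve `s ↦ q s` of `V(M)` is a space-like geodesic of `V(M)`: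
its geodesic curvature vector in `Λ⁴` is normal to `V(M)`. -/
def IsGeodesicInV {M : Type*} [TopologicalSpace M]
    [ChartedSpace (EuclideanSpace ℝ (Fin 2)) M] [IsManifold (𝓡 2) ∞ M]
    (S : Surface M) (q : ℝ → M × ℝ) (J : Set ℝ) : Prop :=
  ∀ s ∈ J, q s ∈ S.V ∧
    0 < lorentz (deriv (S.tangentSphere ∘ q) s) (deriv (S.tangentSphere ∘ q) s) ∧
    ∀ w ∈ S.tangentV (q s), lorentz (geodCurvVector (S.tangentSphere ∘ q) s) w = 0

end DarbouxCurves

end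

noncomputable section

namespace DarbouxCurves

/-! Along the curve write γ for the position, ν for the normal, T = γ', N for the conormal, and m =
(1, γ) for the point of the light cone. Everything reduces to one scalar, ⟨γ''', ν⟩. Since ν' = -k_n
T - τ_g N and γ'' has T-component 0 and N-component k_g, differentiating k_n = ⟨γ'', ν⟩ gives ⟨γ''',
ν⟩ = k_n' + τ_g k_g (`deriv_normalCurv_add`).

For (i), a sphere of Λ⁴ tangent to M at γ is a m + β n with β² = 1. Contact of orders 0 and 1 is
automatic, order 2 forces a = β k_n, and order 3 adds exactly ⟨γ''', ν⟩ = 0 (`hasContact_three_iff`,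
`isDarboux_iff`).

For (ii), the canonical section is σ = k_n m + n (`IsCansec.eq_normalCurv`). Then σ' = k_n' m - τ_g
N has Lorentz square τ_g², which is positive exactly off the principal directions. A tangent vector
of V(M) is κ m + e with e = k dm(v) + dn(v). Its product with σ'' has a T-part ⟨T, e⟩ (k_n' + τ_g
k_g) and an N-part. Passing to arc length cancels the N-part, so the geodesic curvature vector tests
as τ_g⁻² ⟨T, e⟩ (k_n' + τ_g k_g) (`lorentz_geodCurvVector_of_eventuallyEq`). Choosing dm(v) = N
makes ⟨T, e⟩ = -τ_g ≠ 0, so orthogonality to V(M) is the same scalar equation. Density and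
continuity extend it to the whole interval. -/

/-- Product rule for an inner product that is locally constant. -/
theorem inner_add_inner_eq_zero {u v : ℝ → E4} {u' v' : E4} {s a : ℝ}
    (hu : HasDerivAt u u' s) (hv : HasDerivAt v v' s)
    (h : ∀ᶠ t in 𝓝 s, inner ℝ (u t) (v t) = a) :
    inner ℝ u' (v s) + inner ℝ (u s) v' = 0 := by
  have h1 := hu.inner ℝ hv
  have h2 : HasDerivAt (fun t => inner ℝ (u t) (v t)) 0 s :=
    (hasDerivAt_const s a).congr_of_eventuallyEq h
  linarith [h1.unique h2]

/-- Product rule for an inner product of vector-valued maps that is locally constant. -/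
theorem fderiv_inner_add_eq_zero {E : Type*} [NormedAddCommGroup E] [NormedSpace ℝ E]
    {f g : E → E4} {x : E} {a : ℝ} (hf : DifferentiableAt ℝ f x) (hg : DifferentiableAt ℝ g x)
    (h : ∀ᶠ y in 𝓝 x, inner ℝ (f y) (g y) = a) (v : E) :
    inner ℝ (fderiv ℝ f x v) (g x) + inner ℝ (f x) (fderiv ℝ g x v) = 0 := by
  have h1 := fderiv_inner_apply ℝ hf hg v
  have h2 : fderiv ℝ (fun t => inner ℝ (f t) (g t)) x = 0 := by
    rw [Filter.EventuallyEq.fderiv_eq (f := fun _ : E => a) h]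
    simp
  rw [h2] at h1
  simp only [_root_.zero_apply] at h1
  linarith

/-! ### Local charts and the structure equations of the surface -/

namespace Surface

variable {M : Type*} [TopologicalSpace M]
  [ChartedSpace (EuclideanSpace ℝ (Fin 2)) M]

theorem mfderiv_eq_fderiv_comp_extChartAt_symm {f : M → E4}
    (hf : ContMDiff (𝓡 2) 𝓘(ℝ, E4) ∞ f) (p : M) (v : EuclideanSpace ℝ (Fin 2)) :
    (mfderiv (𝓡 2) 𝓘(ℝ, E4) f p : EuclideanSpace ℝ (Fin 2) →L[ℝ] E4) v =
      fderiv ℝ (f ∘ (extChartAt (𝓡 2) p).symm) (extChartAt (𝓡 2) p p) v := by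
  have h := (hf.mdifferentiableAt (by simp) : MDifferentiableAt (𝓡 2) 𝓘(ℝ, E4) f p)
  rw [h.mfderiv]
  simp [writtenInExtChartAt, fderivWithin_univ]
  rfl

theorem deriv_comp_eq_mfderiv {f : M → E4} (hf : ContMDiff (𝓡 2) 𝓘(ℝ, E4) ∞ f) {c : ℝ → M} {s : ℝ}
    (hc : MDifferentiableAt 𝓘(ℝ, ℝ) (𝓡 2) c s) :
    deriv (f ∘ c) s = mfderiv (𝓡 2) 𝓘(ℝ, E4) f (c s) (velocity c s) := by
  have h2 : MDifferentiableAt (𝓡 2) 𝓘(ℝ, E4) f (c s) := hf.mdifferentiableAt (by simp)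
  rw [← fderiv_apply_one_eq_deriv, ← mfderiv_eq_fderiv, mfderiv_comp s h2 hc]
  rfl

variable [IsManifold (𝓡 2) ∞ M]

theorem contDiffOn_comp_extChartAt_symm {f : M → E4} (hf : ContMDiff (𝓡 2) 𝓘(ℝ, E4) ∞ f) (p : M) :
    ContDiffOn ℝ ∞ (f ∘ (extChartAt (𝓡 2) p).symm) (extChartAt (𝓡 2) p).target :=
  contMDiffOn_iff_contDiffOn.1 (hf.comp_contMDiffOn (contMDiffOn_extChartAt_symm p))

theorem contDiffAt_comp_extChartAt_symm {f : M → E4} (hf : ContMDiff (𝓡 2) 𝓘(ℝ, E4) ∞ f) {p : M}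
    {x : EuclideanSpace ℝ (Fin 2)} (hx : x ∈ (extChartAt (𝓡 2) p).target) :
    ContDiffAt ℝ ∞ (f ∘ (extChartAt (𝓡 2) p).symm) x :=
  (contDiffOn_comp_extChartAt_symm hf p).contDiffAt ((isOpen_extChartAt_target p).mem_nhds hx)

/-- Orthogonality of n to M is given pointwise for manifold derivatives. Differentiating it in a
chart requires it at all nearby chart points, not only at the base point. -/
theorem fderiv_comp_extChartAt_symm {f : M → E4}
    (hf : ContMDiff (𝓡 2) 𝓘(ℝ, E4) ∞ f) {p : M} {x : EuclideanSpace ℝ (Fin 2)}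
    (hx : x ∈ (extChartAt (𝓡 2) p).target) (w : EuclideanSpace ℝ (Fin 2)) :
    ∃ v : TangentSpace (𝓡 2) ((extChartAt (𝓡 2) p).symm x),
      fderiv ℝ (f ∘ (extChartAt (𝓡 2) p).symm) x w =
        mfderiv (𝓡 2) 𝓘(ℝ, E4) f ((extChartAt (𝓡 2) p).symm x) v := by
  have h1 : MDifferentiableAt 𝓘(ℝ, EuclideanSpace ℝ (Fin 2)) (𝓡 2)
      (extChartAt (𝓡 2) p).symm x :=
    ((contMDiffOn_extChartAt_symm (n := ∞) p).contMDiffAt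
      ((isOpen_extChartAt_target p).mem_nhds hx)).mdifferentiableAt (by simp)
  have h2 : MDifferentiableAt (𝓡 2) 𝓘(ℝ, E4) f ((extChartAt (𝓡 2) p).symm x) :=
    hf.mdifferentiableAt (by simp)
  refine ⟨mfderiv 𝓘(ℝ, EuclideanSpace ℝ (Fin 2)) (𝓡 2) (extChartAt (𝓡 2) p).symm x w, ?_⟩
  rw [← mfderiv_eq_fderiv, mfderiv_comp x h2 h1]
  rfl

variable (S : Surface M)

theorem inner_pos_pos (p : M) : inner ℝ (S.pos p) (S.pos p) = 1 := by
  rw [real_inner_self_eq_norm_sq, S.norm_pos, one_pow]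

theorem inner_n_n (p : M) : inner ℝ (S.n p) (S.n p) = 1 := by
  rw [real_inner_self_eq_norm_sq, S.norm_n, one_pow]

theorem inner_mfderiv_add {f g : M → E4} (hf : ContMDiff (𝓡 2) 𝓘(ℝ, E4) ∞ f)
    (hg : ContMDiff (𝓡 2) 𝓘(ℝ, E4) ∞ g) {a : ℝ} (h : ∀ p, inner ℝ (f p) (g p) = a) {p : M}
    {F G : EuclideanSpace ℝ (Fin 2) →L[ℝ] E4} (hF : F = mfderiv (𝓡 2) 𝓘(ℝ, E4) f p)
    (hG : G = mfderiv (𝓡 2) 𝓘(ℝ, E4) g p) (v : EuclideanSpace ℝ (Fin 2)) :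
    inner ℝ (F v) (g p) + inner ℝ (f p) (G v) = 0 := by
  have hx := mem_extChartAt_target (I := 𝓡 2) p
  have := fderiv_inner_add_eq_zero
    ((contDiffAt_comp_extChartAt_symm hf hx).differentiableAt (by simp))
    ((contDiffAt_comp_extChartAt_symm hg hx).differentiableAt (by simp))
    (Filter.Eventually.of_forall fun y => h _) v
  have eF : F v = fderiv ℝ (f ∘ (extChartAt (𝓡 2) p).symm) (extChartAt (𝓡 2) p p) v := by
    rw [hF]
    exact mfderiv_eq_fderiv_comp_extChartAt_symm hf p v
  have eG : G v = fderiv ℝ (g ∘ (extChartAt (𝓡 2) p).symm) (extChartAt (𝓡 2) p p) v := by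
    rw [hG]
    exact mfderiv_eq_fderiv_comp_extChartAt_symm hg p v
  rw [eF, eG]
  simpa using this

theorem inner_n_dpos (p : M) (v : TangentSpace (𝓡 2) p) : inner ℝ (S.n p) (S.dpos p v) = 0 :=
  S.n_normal p v

theorem inner_pos_dpos (p : M) (v : TangentSpace (𝓡 2) p) :
    inner ℝ (S.pos p) (S.dpos p v) = 0 := by
  have h := inner_mfderiv_add S.smooth_pos S.smooth_pos S.inner_pos_pos
    (F := S.dpos p) (G := S.dpos p) rfl rfl v
  rw [real_inner_comm] at h
  change inner ℝ (S.pos p) (S.dpos p v) + inner ℝ (S.pos p) (S.dpos p v) = 0 at h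
  linarith

theorem inner_n_dn (p : M) (v : TangentSpace (𝓡 2) p) : inner ℝ (S.n p) (S.dn p v) = 0 := by
  have h := inner_mfderiv_add S.smooth_n S.smooth_n S.inner_n_n
    (F := S.dn p) (G := S.dn p) rfl rfl v
  rw [real_inner_comm] at h
  change inner ℝ (S.n p) (S.dn p v) + inner ℝ (S.n p) (S.dn p v) = 0 at h
  linarith

theorem inner_pos_dn (p : M) (v : TangentSpace (𝓡 2) p) : inner ℝ (S.pos p) (S.dn p v) = 0 := by
  have h := inner_mfderiv_add S.smooth_pos S.smooth_n S.n_tangent_sphere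
    (F := S.dpos p) (G := S.dn p) rfl rfl v
  rw [real_inner_comm] at h
  change inner ℝ (S.n p) (S.dpos p v) + inner ℝ (S.pos p) (S.dn p v) = 0 at h
  linarith [S.inner_n_dpos p v]

/-- The shape operator is symmetric. -/
theorem inner_dn_dpos_comm (p : M) (v w : TangentSpace (𝓡 2) p) :
    inner ℝ (S.dn p v) (S.dpos p w) = inner ℝ (S.dn p w) (S.dpos p v) := by
  set x := extChartAt (𝓡 2) p p with hxdef
  set φ := S.pos ∘ (extChartAt (𝓡 2) p).symm with hφ
  set η := S.n ∘ (extChartAt (𝓡 2) p).symm with hη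
  have hx : x ∈ (extChartAt (𝓡 2) p).target := mem_extChartAt_target (I := 𝓡 2) p
  have hφs : ContDiffAt ℝ ∞ φ x := contDiffAt_comp_extChartAt_symm S.smooth_pos hx
  have hηs : ContDiffAt ℝ ∞ η x := contDiffAt_comp_extChartAt_symm S.smooth_n hx
  have hdφ : DifferentiableAt ℝ (fderiv ℝ φ) x :=
    (hφs.fderiv_right (m := 1) (by norm_cast)).differentiableAt (by simp)
  have hsymm : IsSymmSndFDerivAt ℝ φ x := hφs.isSymmSndFDerivAt (by
    simp [minSmoothness_of_isRCLikeNormedField]; norm_cast)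
  -- Differentiating ⟨n, ∂_b φ⟩ = 0 in the direction a turns the shape operator into minus the
  -- normal component of D²φ(a, b), which is symmetric in a and b.
  have key : ∀ a b : EuclideanSpace ℝ (Fin 2),
      inner ℝ (fderiv ℝ η x a) (fderiv ℝ φ x b) + inner ℝ (η x) (fderiv ℝ (fderiv ℝ φ) x a b)
        = 0 := by
    intro a b
    have h0 : ∀ᶠ y in 𝓝 x, inner ℝ (η y) (fderiv ℝ φ y b) = 0 := by
      filter_upwards [(isOpen_extChartAt_target (I := 𝓡 2) p).mem_nhds hx] with y hy
      obtain ⟨u, hu⟩ := fderiv_comp_extChartAt_symm S.smooth_pos hy b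
      rw [hφ, hu]
      exact S.n_normal _ u
    have h1 := fderiv_inner_add_eq_zero (hηs.differentiableAt (by simp))
      (hdφ.clm_apply (differentiableAt_const b)) h0 a
    rw [fderiv_clm_apply hdφ (differentiableAt_const b)] at h1
    simpa using h1
  have e1 : ∀ u : EuclideanSpace ℝ (Fin 2), S.dpos p u = fderiv ℝ φ x u :=
    mfderiv_eq_fderiv_comp_extChartAt_symm S.smooth_pos p
  have e2 : ∀ u : EuclideanSpace ℝ (Fin 2), S.dn p u = fderiv ℝ η x u :=
    mfderiv_eq_fderiv_comp_extChartAt_symm S.smooth_n p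
  have symm : ∀ a b : EuclideanSpace ℝ (Fin 2),
      inner ℝ (S.dn p a) (S.dpos p b) = inner ℝ (S.dn p b) (S.dpos p a) := by
    intro a b
    have k1 := key a b
    have k2 := key b a
    rw [hsymm.eq a b] at k1
    rw [e1, e1, e2, e2]
    linarith
  exact symm v w

theorem deriv_pos_comp {c : ℝ → M} {s : ℝ} (hc : MDifferentiableAt 𝓘(ℝ, ℝ) (𝓡 2) c s) :
    deriv (S.pos ∘ c) s = S.dpos (c s) (velocity c s) :=
  deriv_comp_eq_mfderiv S.smooth_pos hc

theorem deriv_n_comp {c : ℝ → M} {s : ℝ} (hc : MDifferentiableAt 𝓘(ℝ, ℝ) (𝓡 2) c s) :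
    deriv (S.n ∘ c) s = S.dn (c s) (velocity c s) :=
  deriv_comp_eq_mfderiv S.smooth_n hc

end Surface

/-! ### Curves in S³ with a unit normal field -/

/-- Parseval's identity for four orthonormal vectors of `E4`. -/
theorem inner_eq_sum_of_orthonormal {e : Fin 4 → E4} (he : Orthonormal ℝ e) (x y : E4) :
    inner ℝ x y = ∑ i, inner ℝ x (e i) * inner ℝ (e i) y := by
  have hb : ⊤ ≤ Submodule.span ℝ (Set.range e) := by
    rw [he.linearIndependent.span_eq_top_of_card_eq_finrank (by simp)]
  have := (OrthonormalBasis.mk he hb).sum_inner_mul_inner x y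
  simpa using this.symm

/-- A smooth curve `γ` in `S³` parametrized by arc length, together with a smooth field `ν` of unit
vectors tangent to `S³` and normal to `γ`. -/
structure UnitNormalCurve (γ ν : ℝ → E4) (I : Set ℝ) : Prop where
  isOpen : IsOpen I
  smooth : ContDiffOn ℝ ∞ γ I
  smooth_normal : ContDiffOn ℝ ∞ ν I
  self : ∀ s ∈ I, inner ℝ (γ s) (γ s) = 1
  normal_self : ∀ s ∈ I, inner ℝ (ν s) (ν s) = 1
  self_normal : ∀ s ∈ I, inner ℝ (γ s) (ν s) = 0
  deriv_self : ∀ s ∈ I, inner ℝ (deriv γ s) (deriv γ s) = 1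
  deriv_normal : ∀ s ∈ I, inner ℝ (deriv γ s) (ν s) = 0

theorem contDiffOn_deriv {F : Type*} [NormedAddCommGroup F] [NormedSpace ℝ F] {f : ℝ → F}
    {I : Set ℝ} (hI : IsOpen I) (hf : ContDiffOn ℝ ∞ f I) : ContDiffOn ℝ ∞ (deriv f) I :=
  hf.deriv_of_isOpen hI (by norm_cast)

theorem hasDerivAt_of_contDiffOn {F : Type*} [NormedAddCommGroup F] [NormedSpace ℝ F] {f : ℝ → F}
    {I : Set ℝ} (hI : IsOpen I) (hf : ContDiffOn ℝ ∞ f I) {s : ℝ} (hs : s ∈ I) :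
    HasDerivAt f (deriv f s) s :=
  ((hf.contDiffAt (hI.mem_nhds hs)).differentiableAt (by simp)).hasDerivAt

theorem eventually_of_forall_mem {I : Set ℝ} (hI : IsOpen I) {s : ℝ} (hs : s ∈ I) {p : ℝ → Prop}
    (h : ∀ t ∈ I, p t) : ∀ᶠ t in 𝓝 s, p t :=
  (hI.eventually_mem hs).mono h

/-- The normal curvature of `γ` with respect to `ν`. -/
def curvAlong (γ ν : ℝ → E4) (s : ℝ) : ℝ := inner ℝ (deriv (deriv γ) s) (ν s)

namespace UnitNormalCurve

variable {γ ν : ℝ → E4} {I : Set ℝ} {s : ℝ} (h : UnitNormalCurve γ ν I)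
include h

theorem hasDerivAt_self (hs : s ∈ I) : HasDerivAt γ (deriv γ s) s :=
  hasDerivAt_of_contDiffOn h.isOpen h.smooth hs

theorem hasDerivAt_deriv (hs : s ∈ I) : HasDerivAt (deriv γ) (deriv (deriv γ) s) s :=
  hasDerivAt_of_contDiffOn h.isOpen (contDiffOn_deriv h.isOpen h.smooth) hs

theorem hasDerivAt_deriv_deriv (hs : s ∈ I) :
    HasDerivAt (deriv (deriv γ)) (deriv (deriv (deriv γ)) s) s :=
  hasDerivAt_of_contDiffOn h.isOpen
    (contDiffOn_deriv h.isOpen (contDiffOn_deriv h.isOpen h.smooth)) hs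

theorem hasDerivAt_normal (hs : s ∈ I) : HasDerivAt ν (deriv ν s) s :=
  hasDerivAt_of_contDiffOn h.isOpen h.smooth_normal hs

theorem hasDerivAt_deriv_normal (hs : s ∈ I) : HasDerivAt (deriv ν) (deriv (deriv ν) s) s :=
  hasDerivAt_of_contDiffOn h.isOpen (contDiffOn_deriv h.isOpen h.smooth_normal) hs

theorem inner_self_deriv (hs : s ∈ I) : inner ℝ (γ s) (deriv γ s) = 0 := by
  have := inner_add_inner_eq_zero (h.hasDerivAt_self hs) (h.hasDerivAt_self hs)
    (eventually_of_forall_mem h.isOpen hs h.self)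
  rw [real_inner_comm] at this
  linarith

theorem inner_deriv_deriv_deriv (hs : s ∈ I) :
    inner ℝ (deriv γ s) (deriv (deriv γ) s) = 0 := by
  have := inner_add_inner_eq_zero (h.hasDerivAt_deriv hs) (h.hasDerivAt_deriv hs)
    (eventually_of_forall_mem h.isOpen hs h.deriv_self)
  rw [real_inner_comm] at this
  linarith

theorem inner_self_deriv_deriv (hs : s ∈ I) : inner ℝ (γ s) (deriv (deriv γ) s) = -1 := by
  have := inner_add_inner_eq_zero (h.hasDerivAt_self hs) (h.hasDerivAt_deriv hs)
    (eventually_of_forall_mem h.isOpen hs fun _ ht => h.inner_self_deriv ht)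
  linarith [h.deriv_self s hs]

theorem inner_self_deriv_deriv_deriv (hs : s ∈ I) :
    inner ℝ (γ s) (deriv (deriv (deriv γ)) s) = 0 := by
  have := inner_add_inner_eq_zero (h.hasDerivAt_self hs) (h.hasDerivAt_deriv_deriv hs)
    (eventually_of_forall_mem h.isOpen hs fun _ ht => h.inner_self_deriv_deriv ht)
  linarith [h.inner_deriv_deriv_deriv hs]

theorem inner_normal_deriv_normal (hs : s ∈ I) : inner ℝ (ν s) (deriv ν s) = 0 := by
  have := inner_add_inner_eq_zero (h.hasDerivAt_normal hs) (h.hasDerivAt_normal hs)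
    (eventually_of_forall_mem h.isOpen hs h.normal_self)
  rw [real_inner_comm] at this
  linarith

theorem inner_self_deriv_normal (hs : s ∈ I) : inner ℝ (γ s) (deriv ν s) = 0 := by
  have := inner_add_inner_eq_zero (h.hasDerivAt_self hs) (h.hasDerivAt_normal hs)
    (eventually_of_forall_mem h.isOpen hs h.self_normal)
  linarith [h.deriv_normal s hs]

theorem inner_deriv_deriv_normal (hs : s ∈ I) :
    inner ℝ (deriv γ s) (deriv ν s) = -curvAlong γ ν s := by
  have := inner_add_inner_eq_zero (h.hasDerivAt_deriv hs) (h.hasDerivAt_normal hs)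
    (eventually_of_forall_mem h.isOpen hs h.deriv_normal)
  rw [curvAlong]
  linarith

theorem contDiffOn_curvAlong : ContDiffOn ℝ ∞ (curvAlong γ ν) I :=
  (contDiffOn_deriv h.isOpen (contDiffOn_deriv h.isOpen h.smooth)).inner ℝ h.smooth_normal

theorem hasDerivAt_curvAlong (hs : s ∈ I) :
    HasDerivAt (curvAlong γ ν) (deriv (curvAlong γ ν) s) s :=
  hasDerivAt_of_contDiffOn h.isOpen h.contDiffOn_curvAlong hs

theorem deriv_curvAlong (hs : s ∈ I) :
    deriv (curvAlong γ ν) s =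
      inner ℝ (deriv (deriv (deriv γ)) s) (ν s) + inner ℝ (deriv (deriv γ) s) (deriv ν s) := by
  have := ((h.hasDerivAt_deriv_deriv hs).inner ℝ (h.hasDerivAt_normal hs)).deriv
  rw [add_comm]
  exact this

theorem inner_self_deriv_deriv_normal (hs : s ∈ I) :
    inner ℝ (γ s) (deriv (deriv ν) s) = curvAlong γ ν s := by
  have := inner_add_inner_eq_zero (h.hasDerivAt_self hs) (h.hasDerivAt_deriv_normal hs)
    (eventually_of_forall_mem h.isOpen hs fun _ ht => h.inner_self_deriv_normal ht)
  linarith [h.inner_deriv_deriv_normal hs]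

/-- Obtained by differentiating ⟨γ', ν'⟩ = -k_n; it supplies the T-component of ν'' for the
acceleration of the sphere curve. -/
theorem inner_deriv_deriv_deriv_normal (hs : s ∈ I) :
    inner ℝ (deriv γ s) (deriv (deriv ν) s) =
      -deriv (curvAlong γ ν) s - inner ℝ (deriv (deriv γ) s) (deriv ν s) := by
  have h1 := (h.hasDerivAt_deriv hs).inner ℝ (h.hasDerivAt_deriv_normal hs)
  have h2 := (h.hasDerivAt_curvAlong hs).neg.congr_of_eventuallyEq
    (eventually_of_forall_mem h.isOpen hs fun _ ht => h.inner_deriv_deriv_normal ht)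
  linarith [h1.unique h2]

/-- The sphere `a + ⟨b, ·⟩` with `b = a γ + β ν`, `β² = 1`, has contact of order three with `γ`
if and only if its curvature is the normal curvature and `⟨γ''', ν⟩ = 0`. -/
theorem hasContact_three_iff (hs : s ∈ I) {a β : ℝ} (hβ : β ≠ 0) :
    HasContact γ s (a, a • γ s + β • ν s) 3 ↔
      a = β * curvAlong γ ν s ∧ inner ℝ (deriv (deriv (deriv γ)) s) (ν s) = 0 := by
  set b : E4 := a • γ s + β • ν s with hb
  have hd : ∀ {f f' : ℝ → E4} {t : ℝ}, HasDerivAt f (f' t) t →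
      HasDerivAt (fun t => inner ℝ b (f t)) (inner ℝ b (f' t)) t := by
    intro f f' t hf
    simpa using (hasDerivAt_const t b).inner ℝ hf
  have d0 : (fun t => lorentz (a, b) (light (γ t))) = fun t => -a + inner ℝ b (γ t) := by
    funext t
    simp [lorentz, light]
  have d1 : ∀ t ∈ I, deriv (fun t => lorentz (a, b) (light (γ t))) t = inner ℝ b (deriv γ t) := by
    intro t ht
    rw [d0]
    exact ((hd (h.hasDerivAt_self ht)).const_add (-a)).deriv
  have d2 : ∀ t ∈ I, deriv (deriv (fun t => lorentz (a, b) (light (γ t)))) t =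
      inner ℝ b (deriv (deriv γ) t) := by
    intro t ht
    rw [Filter.EventuallyEq.deriv_eq (eventually_of_forall_mem h.isOpen ht d1)]
    exact (hd (h.hasDerivAt_deriv ht)).deriv
  have d3 : deriv (deriv (deriv (fun t => lorentz (a, b) (light (γ t))))) s =
      inner ℝ b (deriv (deriv (deriv γ)) s) := by
    rw [Filter.EventuallyEq.deriv_eq (eventually_of_forall_mem h.isOpen hs d2)]
    exact (hd (h.hasDerivAt_deriv_deriv hs)).deriv
  -- Orders 0 and 1 vanish for every a and β; only orders 2 and 3 carry conditions.
  have e0 : lorentz (a, b) (light (γ s)) = 0 := by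
    have h0 : inner ℝ (ν s) (γ s) = 0 := by rw [real_inner_comm, h.self_normal s hs]
    simp only [lorentz, light, hb, inner_add_left, real_inner_smul_left, h.self s hs, h0]
    ring
  have e1 : inner ℝ b (deriv γ s) = 0 := by
    rw [hb, inner_add_left, real_inner_smul_left, real_inner_smul_left, h.inner_self_deriv hs,
      real_inner_comm, h.deriv_normal s hs]
    ring
  have e2 : inner ℝ b (deriv (deriv γ) s) = -a + β * curvAlong γ ν s := by
    rw [hb, inner_add_left, real_inner_smul_left, real_inner_smul_left,
      h.inner_self_deriv_deriv hs, real_inner_comm, curvAlong]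
    ring
  have e3 : inner ℝ b (deriv (deriv (deriv γ)) s) =
      β * inner ℝ (deriv (deriv (deriv γ)) s) (ν s) := by
    rw [hb, inner_add_left, real_inner_smul_left, real_inner_smul_left,
      h.inner_self_deriv_deriv_deriv hs, real_inner_comm]
    ring
  rw [HasContact]
  constructor
  · intro hc
    have c2 := hc 2 (by norm_num)
    have c3 := hc 3 (by norm_num)
    simp only [iteratedDeriv_succ, iteratedDeriv_zero] at c2 c3
    rw [d2 s hs, e2] at c2
    rw [d3, e3] at c3
    exact ⟨by linarith, (mul_eq_zero.1 c3).resolve_left hβ⟩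
  · rintro ⟨c2, c3⟩ j hj
    interval_cases j
    · simpa only [iteratedDeriv_zero] using e0
    · simp only [iteratedDeriv_succ, iteratedDeriv_zero]
      rw [d1 s hs, e1]
    · simp only [iteratedDeriv_succ, iteratedDeriv_zero]
      rw [d2 s hs, e2]
      linarith
    · simp only [iteratedDeriv_succ, iteratedDeriv_zero]
      rw [d3, e3, c3, mul_zero]

/-- Parseval's identity in the frame `γ, ν, γ', N`. -/
theorem inner_eq_frame (hs : s ∈ I) {N : E4} (hN : inner ℝ N N = 1) (hγN : inner ℝ (γ s) N = 0)
    (hνN : inner ℝ (ν s) N = 0) (hTN : inner ℝ (deriv γ s) N = 0) (x y : E4) :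
    inner ℝ x y = inner ℝ (γ s) x * inner ℝ (γ s) y + inner ℝ (ν s) x * inner ℝ (ν s) y +
      inner ℝ (deriv γ s) x * inner ℝ (deriv γ s) y + inner ℝ N x * inner ℝ N y := by
  have n1 : ∀ {z : E4}, inner ℝ z z = 1 → ‖z‖ = 1 := by
    intro z hz
    rw [real_inner_self_eq_norm_sq] at hz
    exact (pow_eq_one_iff_of_nonneg (norm_nonneg z) two_ne_zero).1 hz
  have he : Orthonormal ℝ ![γ s, ν s, deriv γ s, N] := by
    refine ⟨fun i => ?_, fun i j hij => ?_⟩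
    · fin_cases i
      · exact n1 (h.self s hs)
      · exact n1 (h.normal_self s hs)
      · exact n1 (h.deriv_self s hs)
      · exact n1 hN
    · have a1 := h.self_normal s hs
      have a2 := h.inner_self_deriv hs
      have a3 := h.deriv_normal s hs
      fin_cases i <;> fin_cases j <;> first | exact absurd rfl hij | assumption |
        exact (real_inner_comm _ _).trans (by assumption)
  rw [inner_eq_sum_of_orthonormal he, Fin.sum_univ_four]
  simp only [Matrix.cons_val]
  rw [real_inner_comm (γ s) x, real_inner_comm (ν s) x, real_inner_comm (deriv γ s) x,
    real_inner_comm N x]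

end UnitNormalCurve

/-! ### Lorentz form and geodesic curvature vector -/

theorem lorentz_add_left (u v w : L5) : lorentz (u + v) w = lorentz u w + lorentz v w := by
  simp only [lorentz, Prod.fst_add, Prod.snd_add, inner_add_left]
  ring

theorem lorentz_smul_left (a : ℝ) (u w : L5) : lorentz (a • u) w = a * lorentz u w := by
  simp only [lorentz, Prod.smul_fst, Prod.smul_snd, real_inner_smul_left, smul_eq_mul]
  ring

theorem lorentz_comm (u v : L5) : lorentz u v = lorentz v u := by
  rw [lorentz, lorentz, real_inner_comm, mul_comm]

theorem hasDerivAt_lorentz {u v : ℝ → L5} {u' v' : L5} {s : ℝ} (hu : HasDerivAt u u' s)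
    (hv : HasDerivAt v v' s) :
    HasDerivAt (fun t => lorentz (u t) (v t)) (lorentz (u s) v' + lorentz u' (v s)) s := by
  have hfst : ∀ {f : ℝ → L5} {f' : L5}, HasDerivAt f f' s → HasDerivAt (fun t => (f t).1) f'.1 s :=
    fun hf => (ContinuousLinearMap.fst ℝ ℝ E4).hasFDerivAt.comp_hasDerivAt s hf
  have hsnd : ∀ {f : ℝ → L5} {f' : L5}, HasDerivAt f f' s → HasDerivAt (fun t => (f t).2) f'.2 s :=
    fun hf => (ContinuousLinearMap.snd ℝ ℝ E4).hasFDerivAt.comp_hasDerivAt s hf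
  have h := ((hfst hu).mul (hfst hv)).neg.add ((hsnd hu).inner ℝ (hsnd hv))
  refine h.congr_deriv ?_
  simp only [lorentz]
  ring

/-- The geodesic curvature vector, tested against vectors tangent to `Λ⁴`. -/
theorem lorentz_geodCurvVector {σ : ℝ → L5} {σ'' : L5} {s : ℝ}
    (h2 : HasDerivAt (deriv σ) σ'' s) (hpos : 0 < lorentz (deriv σ s) (deriv σ s)) {w : L5}
    (hw : lorentz (σ s) w = 0) :
    lorentz (geodCurvVector σ s) w = (lorentz (deriv σ s) (deriv σ s))⁻¹ *
      (lorentz σ'' w -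
        lorentz σ'' (deriv σ s) / lorentz (deriv σ s) (deriv σ s) * lorentz (deriv σ s) w) := by
  set g := lorentz (deriv σ s) (deriv σ s) with hg
  have hsq : Real.sqrt g ^ 2 = g := Real.sq_sqrt hpos.le
  have hne : Real.sqrt g ≠ 0 := (Real.sqrt_pos.2 hpos).ne'
  have hgd : HasDerivAt (fun t => lorentz (deriv σ t) (deriv σ t))
      (2 * lorentz σ'' (deriv σ s)) s := by
    refine (hasDerivAt_lorentz h2 h2).congr_deriv ?_
    rw [lorentz_comm (deriv σ s) σ'']
    ring
  have hA : HasDerivAt (arcDeriv σ σ)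
      ((Real.sqrt g)⁻¹ • σ'' +
        (-(2 * lorentz σ'' (deriv σ s) / (2 * Real.sqrt g)) / Real.sqrt g ^ 2) • deriv σ s) s :=
    ((hgd.sqrt hpos.ne').inv hne).smul h2
  have e : lorentz (geodCurvVector σ s) w = lorentz (arcDeriv σ (arcDeriv σ σ) s) w := by
    rw [geodCurvVector, sub_eq_add_neg, ← neg_smul, lorentz_add_left, lorentz_smul_left, hw]
    ring
  rw [e, arcDeriv, hA.deriv, lorentz_smul_left, lorentz_add_left, lorentz_smul_left,
    lorentz_smul_left, lorentzSpeed, ← hg]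
  have hg0 : g ≠ 0 := hpos.ne'
  have hinv : g⁻¹ = (Real.sqrt g)⁻¹ * (Real.sqrt g)⁻¹ := by
    rw [← mul_inv, ← sq, hsq]
  rw [hsq, hinv]
  field_simp
  ring

/-! ### The curve of spheres k_n m + n -/

/-- The curve of the tangent spheres along `γ` whose curvature is the normal curvature. -/
def sphereAlong (γ ν : ℝ → E4) (s : ℝ) : L5 :=
  (curvAlong γ ν s, curvAlong γ ν s • γ s + ν s)

namespace UnitNormalCurve

variable {γ ν : ℝ → E4} {I : Set ℝ} {s : ℝ} (h : UnitNormalCurve γ ν I)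
include h

theorem hasDerivAt_sphereAlong (hs : s ∈ I) : HasDerivAt (sphereAlong γ ν)
    (deriv (curvAlong γ ν) s, deriv (curvAlong γ ν) s • γ s +
      (curvAlong γ ν s • deriv γ s + deriv ν s)) s := by
  have hK := h.hasDerivAt_curvAlong hs
  refine (hK.prodMk ((hK.smul (h.hasDerivAt_self hs)).add (h.hasDerivAt_normal hs))).congr_deriv ?_
  congr 1
  abel

theorem hasDerivAt_deriv_sphereAlong (hs : s ∈ I) : HasDerivAt (deriv (sphereAlong γ ν))
    (deriv (deriv (curvAlong γ ν)) s, deriv (deriv (curvAlong γ ν)) s • γ s +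
      (2 * deriv (curvAlong γ ν) s) • deriv γ s + curvAlong γ ν s • deriv (deriv γ) s +
        deriv (deriv ν) s) s := by
  have hK := h.hasDerivAt_curvAlong hs
  have hK1 : HasDerivAt (deriv (curvAlong γ ν)) (deriv (deriv (curvAlong γ ν)) s) s :=
    hasDerivAt_of_contDiffOn h.isOpen (contDiffOn_deriv h.isOpen h.contDiffOn_curvAlong) hs
  have := hK1.prodMk ((hK1.smul (h.hasDerivAt_self hs)).add
    ((hK.smul (h.hasDerivAt_deriv hs)).add (h.hasDerivAt_deriv_normal hs)))
  refine (this.congr_deriv ?_).congr_of_eventuallyEq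
    (eventually_of_forall_mem h.isOpen hs fun t ht => (h.hasDerivAt_sphereAlong ht).deriv)
  congr 1
  module

variable {N : E4}

/-- In the frame γ, ν, T, N the first three products vanish: ν' has no γ- or ν-component and γ'' has
no T-component. What remains is -k_g τ_g. -/
theorem inner_deriv_deriv_deriv_normal_eq (hs : s ∈ I) (hN : inner ℝ N N = 1)
    (hγN : inner ℝ (γ s) N = 0) (hνN : inner ℝ (ν s) N = 0) (hTN : inner ℝ (deriv γ s) N = 0) :
    inner ℝ (deriv (deriv γ) s) (deriv ν s) =
      inner ℝ N (deriv (deriv γ) s) * inner ℝ N (deriv ν s) := by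
  rw [h.inner_eq_frame hs hN hγN hνN hTN, h.inner_self_deriv_normal hs,
    h.inner_normal_deriv_normal hs, h.inner_deriv_deriv_deriv hs]
  ring

/-- The T-components of k_n γ' and ν' cancel, leaving σ' = k_n' m + ⟨N, ν'⟩ N. The light-like vector
m is Lorentz-orthogonal to itself and to (0, e) when e ⟂ γ, so only the N-components meet. -/
theorem lorentz_deriv_sphereAlong (hs : s ∈ I) (hN : inner ℝ N N = 1)
    (hγN : inner ℝ (γ s) N = 0) (hνN : inner ℝ (ν s) N = 0) (hTN : inner ℝ (deriv γ s) N = 0)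
    {κ : ℝ} {e : E4} (hγe : inner ℝ (γ s) e = 0) (hνe : inner ℝ (ν s) e = 0) :
    lorentz (deriv (sphereAlong γ ν) s) (κ, κ • γ s + e) = inner ℝ N (deriv ν s) * inner ℝ N e := by
  rw [(h.hasDerivAt_sphereAlong hs).deriv]
  have e1 : inner ℝ (deriv γ s) (γ s) = 0 := by rw [real_inner_comm, h.inner_self_deriv hs]
  have e2 : inner ℝ (deriv ν s) (γ s) = 0 := by rw [real_inner_comm, h.inner_self_deriv_normal hs]
  simp only [lorentz, inner_add_left, inner_add_right, real_inner_smul_left, real_inner_smul_right,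
    h.self s hs, hγe, e1, e2]
  rw [h.inner_eq_frame hs hN hγN hνN hTN (deriv ν s) e, hγe, hνe, h.inner_deriv_deriv_normal hs]
  ring

/-- The T-component of σ'' is 2k_n' from the product rule minus k_n' + ⟨γ'', ν'⟩ from ν'': this is
where the Darboux expression enters. The κ-terms cancel because ⟨γ, γ''⟩ = -1 and ⟨γ, ν''⟩ = k_n. -/
theorem lorentz_deriv_deriv_sphereAlong (hs : s ∈ I) (hN : inner ℝ N N = 1)
    (hγN : inner ℝ (γ s) N = 0) (hνN : inner ℝ (ν s) N = 0) (hTN : inner ℝ (deriv γ s) N = 0)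
    {κ : ℝ} {e : E4} (hγe : inner ℝ (γ s) e = 0) (hνe : inner ℝ (ν s) e = 0) :
    lorentz (deriv (deriv (sphereAlong γ ν)) s) (κ, κ • γ s + e) =
      inner ℝ (deriv γ s) e *
        (deriv (curvAlong γ ν) s - inner ℝ N (deriv (deriv γ) s) * inner ℝ N (deriv ν s)) +
      (curvAlong γ ν s * inner ℝ N (deriv (deriv γ) s) + inner ℝ N (deriv (deriv ν) s)) *
        inner ℝ N e := by
  rw [(h.hasDerivAt_deriv_sphereAlong hs).deriv]
  have e1 : inner ℝ (deriv γ s) (γ s) = 0 := by rw [real_inner_comm, h.inner_self_deriv hs]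
  have e2 : inner ℝ (deriv (deriv ν) s) (γ s) = curvAlong γ ν s := by
    rw [real_inner_comm, h.inner_self_deriv_deriv_normal hs]
  have e3 : inner ℝ (deriv (deriv γ) s) (γ s) = -1 := by
    rw [real_inner_comm, h.inner_self_deriv_deriv hs]
  simp only [lorentz, inner_add_left, inner_add_right, real_inner_smul_left, real_inner_smul_right,
    h.self s hs, hγe, e1, e2, e3]
  rw [h.inner_eq_frame hs hN hγN hνN hTN (deriv (deriv ν) s) e,
    h.inner_eq_frame hs hN hγN hνN hTN (deriv (deriv γ) s) e, hγe, hνe,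
    h.inner_deriv_deriv_deriv_normal hs, h.inner_deriv_deriv_deriv hs,
    h.inner_deriv_deriv_deriv_normal_eq hs hN hγN hνN hTN]
  ring

theorem lorentz_deriv_sphereAlong_self (hs : s ∈ I) (hN : inner ℝ N N = 1)
    (hγN : inner ℝ (γ s) N = 0) (hνN : inner ℝ (ν s) N = 0) (hTN : inner ℝ (deriv γ s) N = 0) :
    lorentz (deriv (sphereAlong γ ν) s) (deriv (sphereAlong γ ν) s) =
      inner ℝ N (deriv ν s) ^ 2 ∧
    lorentz (deriv (deriv (sphereAlong γ ν)) s) (deriv (sphereAlong γ ν) s) =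
      (curvAlong γ ν s * inner ℝ N (deriv (deriv γ) s) + inner ℝ N (deriv (deriv ν) s)) *
        inner ℝ N (deriv ν s) := by
  have hγe : inner ℝ (γ s) (curvAlong γ ν s • deriv γ s + deriv ν s) = 0 := by
    rw [inner_add_right, real_inner_smul_right, h.inner_self_deriv hs,
      h.inner_self_deriv_normal hs]
    ring
  have hνe : inner ℝ (ν s) (curvAlong γ ν s • deriv γ s + deriv ν s) = 0 := by
    rw [inner_add_right, real_inner_smul_right, real_inner_comm, h.deriv_normal s hs,
      h.inner_normal_deriv_normal hs]
    ring
  have hTe : inner ℝ (deriv γ s) (curvAlong γ ν s • deriv γ s + deriv ν s) = 0 := by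
    rw [inner_add_right, real_inner_smul_right, h.deriv_self s hs, h.inner_deriv_deriv_normal hs]
    ring
  have hNe : inner ℝ N (curvAlong γ ν s • deriv γ s + deriv ν s) = inner ℝ N (deriv ν s) := by
    rw [inner_add_right, real_inner_smul_right, real_inner_comm, hTN]
    ring
  have l1 := h.lorentz_deriv_sphereAlong hs hN hγN hνN hTN
    (κ := deriv (curvAlong γ ν) s) hγe hνe
  have l2 := h.lorentz_deriv_deriv_sphereAlong hs hN hγN hνN hTN
    (κ := deriv (curvAlong γ ν) s) hγe hνe
  rw [← (h.hasDerivAt_sphereAlong hs).deriv] at l1 l2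
  rw [l1, l2, hTe, hNe]
  constructor <;> ring

/-- The geodesic curvature vector of `sphereAlong`, tested against the vectors
`κ m + e` tangent to `Λ⁴` and to the spheres `k m + n`. -/
theorem lorentz_geodCurvVector_of_eventuallyEq (hs : s ∈ I) (hN : inner ℝ N N = 1)
    (hγN : inner ℝ (γ s) N = 0) (hνN : inner ℝ (ν s) N = 0) (hTN : inner ℝ (deriv γ s) N = 0)
    (hτ : inner ℝ N (deriv ν s) ≠ 0) {σ : ℝ → L5} (hσ : σ =ᶠ[𝓝 s] sphereAlong γ ν)
    {κ : ℝ} {e : E4} (hγe : inner ℝ (γ s) e = 0) (hνe : inner ℝ (ν s) e = 0) :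
    lorentz (geodCurvVector σ s) (κ, κ • γ s + e) = (inner ℝ N (deriv ν s) ^ 2)⁻¹ *
      (inner ℝ (deriv γ s) e *
        (deriv (curvAlong γ ν) s - inner ℝ N (deriv (deriv γ) s) * inner ℝ N (deriv ν s))) := by
  have hd : deriv σ s = deriv (sphereAlong γ ν) s := hσ.deriv_eq
  have h2 : HasDerivAt (deriv σ) (deriv (deriv (sphereAlong γ ν)) s) s :=
    (h.hasDerivAt_deriv_sphereAlong hs).differentiableAt.hasDerivAt.congr_of_eventuallyEq hσ.deriv
  obtain ⟨l1, l2⟩ := h.lorentz_deriv_sphereAlong_self hs hN hγN hνN hTN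
  have hw : lorentz (σ s) (κ, κ • γ s + e) = 0 := by
    have e1 : inner ℝ (ν s) (γ s) = 0 := by rw [real_inner_comm, h.self_normal s hs]
    rw [hσ.eq_of_nhds]
    simp only [lorentz, sphereAlong, inner_add_left, inner_add_right, real_inner_smul_left,
      real_inner_smul_right, h.self s hs, e1, hγe, hνe]
    ring
  rw [lorentz_geodCurvVector h2 (by rw [hd, l1]; positivity) hw, hd, l1, l2,
    h.lorentz_deriv_sphereAlong hs hN hγN hνN hTN hγe hνe,
    h.lorentz_deriv_deriv_sphereAlong hs hN hγN hνN hTN hγe hνe]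
  -- The arc-length correction is a multiple of σ', which pairs with the test vector through N
  -- alone, and it removes exactly the N-part of σ''.
  field_simp
  ring

end UnitNormalCurve

theorem contDiffAt_deriv {F : Type*} [NormedAddCommGroup F] [NormedSpace ℝ F] {f : ℝ → F} {t : ℝ}
    (hf : ContDiffAt ℝ ∞ f t) : ContDiffAt ℝ ∞ (deriv f) t := by
  have h : ContDiffAt ℝ ∞ (fun u => fderiv ℝ f u 1) t :=
    (hf.fderiv_right (by norm_cast)).clm_apply contDiffAt_const
  exact h

/-! ### Curves on the surface and the canonical section -/

namespace Surface

variable {M : Type*} [TopologicalSpace M]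
  [ChartedSpace (EuclideanSpace ℝ (Fin 2)) M] [IsManifold (𝓡 2) ∞ M]
  {S : Surface M} {c : ℝ → M} {I : Set ℝ} {s : ℝ}

theorem IsUnitSpeed.mdifferentiableAt (hc : S.IsUnitSpeed c I) (hI : IsOpen I) (hs : s ∈ I) :
    MDifferentiableAt 𝓘(ℝ, ℝ) (𝓡 2) c s :=
  (hc.1.contMDiffAt (hI.mem_nhds hs)).mdifferentiableAt (by simp)

theorem IsUnitSpeed.unitNormalCurve (hc : S.IsUnitSpeed c I) (hI : IsOpen I) :
    UnitNormalCurve (S.pos ∘ c) (S.n ∘ c) I where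
  isOpen := hI
  smooth := contMDiffOn_iff_contDiffOn.1 (S.smooth_pos.comp_contMDiffOn hc.1)
  smooth_normal := contMDiffOn_iff_contDiffOn.1 (S.smooth_n.comp_contMDiffOn hc.1)
  self _ _ := S.inner_pos_pos _
  normal_self _ _ := S.inner_n_n _
  self_normal _ _ := S.n_tangent_sphere _
  deriv_self s hs := by rw [real_inner_self_eq_norm_sq, hc.2 s hs, one_pow]
  deriv_normal s hs := by
    rw [S.deriv_pos_comp (hc.mdifferentiableAt hI hs), real_inner_comm]
    exact S.inner_n_dpos _ _

/-- The normal curvature is the second fundamental form of the velocity, for a curve with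
arbitrary parametrization. -/
theorem inner_n_deriv_deriv {β : ℝ → M} {t : ℝ} (hβ : ContMDiffAt 𝓘(ℝ, ℝ) (𝓡 2) ∞ β t) :
    inner ℝ (S.n (β t)) (deriv (deriv (S.pos ∘ β)) t) =
      -inner ℝ (deriv (S.n ∘ β) t) (deriv (S.pos ∘ β) t) := by
  have hp : ContDiffAt ℝ ∞ (S.pos ∘ β) t :=
    contMDiffAt_iff_contDiffAt.1 (S.smooth_pos.contMDiffAt.comp t hβ)
  have hn : ContDiffAt ℝ ∞ (S.n ∘ β) t :=
    contMDiffAt_iff_contDiffAt.1 (S.smooth_n.contMDiffAt.comp t hβ)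
  have hp1 : DifferentiableAt ℝ (deriv (S.pos ∘ β)) t :=
    (contDiffAt_deriv hp).differentiableAt (by simp)
  have h0 : ∀ᶠ u in 𝓝 t, inner ℝ ((S.n ∘ β) u) (deriv (S.pos ∘ β) u) = 0 := by
    -- Regularity at a point spreads to a neighbourhood only at a finite order, so C¹ is extracted
    -- first.
    have hβ1 : ContMDiffAt 𝓘(ℝ, ℝ) (𝓡 2) 1 β t := hβ.of_le (by norm_cast)
    have : IsManifold (𝓡 2) 1 M := IsManifold.of_le (n := ∞) (by norm_cast)
    filter_upwards [(contMDiffAt_iff_contMDiffAt_nhds (by simp)).1 hβ1] with u hu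
    rw [S.deriv_pos_comp (hu.mdifferentiableAt (by simp))]
    exact S.inner_n_dpos _ _
  have := inner_add_inner_eq_zero (hn.differentiableAt (by simp)).hasDerivAt hp1.hasDerivAt h0
  simp only [Function.comp_apply] at this
  linarith

theorem exists_deriv_eq_of_eq {β : ℝ → M} {t : ℝ} (hβ : MDifferentiableAt 𝓘(ℝ, ℝ) (𝓡 2) β t)
    {p : M} (hp : β t = p) : ∃ v : TangentSpace (𝓡 2) p,
      deriv (S.pos ∘ β) t = S.dpos p v ∧ deriv (S.n ∘ β) t = S.dn p v := by
  subst hp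
  exact ⟨_, S.deriv_pos_comp hβ, S.deriv_n_comp hβ⟩

/-- A tangent sphere one branch of whose intersection with `M` is tangent to the curve has the
normal curvature of the curve as its curvature. -/
theorem BranchTangent.eq_normalCurv (hc : S.IsUnitSpeed c I) (hI : IsOpen I) (hs : s ∈ I) {k : ℝ}
    (h : S.BranchTangent c s (S.tangentSphere (c s, k))) : k = S.normalCurv c s := by
  obtain ⟨β, hβ0, hβ, ⟨a, ha, hT⟩, hsph⟩ := h
  have hf := hc.unitNormalCurve hI
  have hp : ContDiffAt ℝ ∞ (S.pos ∘ β) 0 :=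
    contMDiffAt_iff_contDiffAt.1 (S.smooth_pos.contMDiffAt.comp 0 hβ)
  have hp1 : DifferentiableAt ℝ (deriv (S.pos ∘ β)) 0 :=
    (contDiffAt_deriv hp).differentiableAt (by simp)
  have hpd : ∀ᶠ t in 𝓝 (0 : ℝ), HasDerivAt (S.pos ∘ β) (deriv (S.pos ∘ β) t) t := by
    filter_upwards [(hp.of_le (m := 1) (by norm_cast)).eventually (by simp)] with t ht
    exact (ht.differentiableAt (by simp)).hasDerivAt
  -- Since dm is injective, proportional velocities in ℝ⁴ come from proportional tangent vectors of
  -- M, so the derivatives of n are proportional too.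
  have hn' : deriv (S.n ∘ β) 0 = a • deriv (S.n ∘ c) s := by
    obtain ⟨v, hv1, hv2⟩ := exists_deriv_eq_of_eq (S := S) (hβ.mdifferentiableAt (by simp)) hβ0
    have hcs := hc.mdifferentiableAt hI hs
    rw [hv1, S.deriv_pos_comp hcs, ← map_smul] at hT
    rw [hv2, S.deriv_n_comp hcs, S.immersion _ hT, map_smul]
  have h1 : ∀ᶠ t in 𝓝 (0 : ℝ), inner ℝ (deriv (S.pos ∘ β) t) ((S.pos ∘ β) t) = 0 := by
    filter_upwards [hpd] with t ht
    have := inner_add_inner_eq_zero ht ht (Filter.Eventually.of_forall fun u => S.inner_pos_pos _)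
    rw [real_inner_comm ((S.pos ∘ β) t)] at this
    rw [real_inner_comm]
    linarith
  have h2 := inner_add_inner_eq_zero hp1.hasDerivAt hpd.self_of_nhds h1
  -- Lying in the sphere means ⟨k m + n, β⟩ = k. Two derivatives at 0, with ⟨m, β''⟩ = -a² and ⟨n,
  -- β''⟩ = a² k_n, give a² (k - k_n) = 0.
  have h3 : ∀ᶠ t in 𝓝 (0 : ℝ), inner ℝ (k • S.pos (c s) + S.n (c s)) ((S.pos ∘ β) t) = k := by
    filter_upwards [hsph] with t ht
    have := ht.2
    simp only [lorentz, tangentSphere, light, Prod.fst_add, Prod.snd_add, Prod.smul_fst,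
      Prod.smul_snd, smul_eq_mul] at this
    simp only [Function.comp_apply]
    linarith
  have h4 : ∀ᶠ t in 𝓝 (0 : ℝ),
      inner ℝ (k • S.pos (c s) + S.n (c s)) (deriv (S.pos ∘ β) t) = 0 := by
    filter_upwards [hpd, h3.eventually_nhds] with t ht h3t
    have := inner_add_inner_eq_zero (hasDerivAt_const t _) ht h3t
    simpa using this
  have h5 := inner_add_inner_eq_zero (hasDerivAt_const 0 _) hp1.hasDerivAt h4
  have h6 := inner_n_deriv_deriv (S := S) hβ
  rw [hT, real_inner_smul_left, real_inner_smul_right, hf.deriv_self s hs] at h2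
  rw [hn', hT, real_inner_smul_left, real_inner_smul_right,
    real_inner_comm (deriv (S.pos ∘ c) s), hf.inner_deriv_deriv_normal hs, hβ0] at h6
  simp only [inner_zero_left, zero_add, inner_add_left, real_inner_smul_left, h6] at h5
  rw [real_inner_comm, Function.comp_apply, hβ0] at h2
  have h7 : a ^ 2 * (k - S.normalCurv c s) = 0 := by
    change k * inner ℝ (S.pos (c s)) (deriv (deriv (S.pos ∘ β)) 0) +
      -(a * (a * -S.normalCurv c s)) = 0 at h5
    linear_combination k * h2 - h5
  have := (mul_eq_zero.1 h7).resolve_left (pow_ne_zero 2 ha)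
  linarith

/-- Both clauses of the definition force the normal curvature, so k is smooth even across principal
parameters and may be differentiated. -/
theorem IsCansec.eq_normalCurv {k : ℝ → ℝ} (h : S.IsCansec c I k) (hc : S.IsUnitSpeed c I)
    (hI : IsOpen I) (hs : s ∈ I) : k s = S.normalCurv c s := by
  by_cases hp : s ∈ S.nonPrincipal c I
  · exact ((h s hs).1 hp).eq_normalCurv hc hI hs
  · have hd := ((h s hs).2 hp).2
    have hf := hc.unitNormalCurve hI
    have hcs := hc.mdifferentiableAt hI hs
    rw [← S.deriv_n_comp hcs, ← S.deriv_pos_comp hcs] at hd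
    have h1 := hf.inner_deriv_deriv_normal hs
    rw [hd, real_inner_smul_right, hf.deriv_self s hs] at h1
    change -k s * 1 = -S.normalCurv c s at h1
    linarith

/-- The properties of the unit conormal at one point, in the form used with the frame. -/
structure ConormalAt (S : Surface M) (c : ℝ → M) (s : ℝ) (N : E4) : Prop where
  self : inner ℝ N N = 1
  pos : inner ℝ ((S.pos ∘ c) s) N = 0
  normal : inner ℝ ((S.n ∘ c) s) N = 0
  velocity : inner ℝ (deriv (S.pos ∘ c) s) N = 0

theorem IsUnitConormal.conormalAt {N₁ : ℝ → E4} (hN : S.IsUnitConormal c I N₁) (hs : s ∈ I) :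
    ConormalAt S c s (N₁ s) := by
  obtain ⟨h1, ⟨v, hv⟩, h3⟩ := hN s hs
  refine ⟨by rw [real_inner_self_eq_norm_sq, h1, one_pow], ?_, ?_, h3⟩
  · rw [← hv]
    exact S.inner_pos_dpos _ v
  · rw [← hv]
    exact S.inner_n_dpos _ v

/-- The right-hand side does not involve N₁, so the Darboux expression is independent of its sign
and needs no regularity of N₁. -/
theorem deriv_normalCurv_add (hc : S.IsUnitSpeed c I) (hI : IsOpen I) {N₁ : ℝ → E4}
    (hN : S.IsUnitConormal c I N₁) (hs : s ∈ I) :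
    deriv (S.normalCurv c) s + S.geodTorsion c N₁ s * S.geodCurv c N₁ s =
      inner ℝ (deriv (deriv (deriv (S.pos ∘ c))) s) (S.n (c s)) := by
  have hf := hc.unitNormalCurve hI
  have hn := hN.conormalAt hs
  have h1 := hf.deriv_curvAlong hs
  rw [hf.inner_deriv_deriv_deriv_normal_eq hs hn.self hn.pos hn.normal hn.velocity] at h1
  change deriv (S.normalCurv c) s = _ at h1
  rw [h1, geodTorsion, geodCurv, real_inner_comm (N₁ s) (deriv (S.n ∘ c) s),
    real_inner_comm (N₁ s) (deriv (deriv (S.pos ∘ c)) s)]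
  simp only [Function.comp_apply]
  ring

/-! ### Tangent spheres and the Darboux condition -/

/-- The spheres tangent to `M` along a curve. -/
theorem IsTangentAt.exists_eq (hc : S.IsUnitSpeed c I) (hI : IsOpen I) {N₁ : ℝ → E4}
    (hN : S.IsUnitConormal c I N₁) (hs : s ∈ I) {σ : L5} (hσ : S.IsTangentAt (c s) σ) :
    ∃ a β : ℝ, σ = (a, a • (S.pos ∘ c) s + β • (S.n ∘ c) s) := by
  have hf := hc.unitNormalCurve hI
  have hn := hN.conormalAt hs
  obtain ⟨a, b⟩ := σ
  refine ⟨a, inner ℝ ((S.n ∘ c) s) b, ?_⟩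
  -- Passing through the point fixes the γ-component of b; tangency kills its T- and N-components,
  -- so only the ν-component is free.
  have h0 : inner ℝ ((S.pos ∘ c) s) b = a := by
    have := hσ.1.2
    simp only [lorentz, light] at this
    rw [real_inner_comm, Function.comp_apply]
    linarith
  have h1 : ∀ v, inner ℝ (S.dpos (c s) v) b = 0 := by
    intro v
    have := hσ.2 v
    simp only [lorentz] at this
    rw [real_inner_comm]
    linarith
  have hT : inner ℝ (deriv (S.pos ∘ c) s) b = 0 := by
    rw [S.deriv_pos_comp (hc.mdifferentiableAt hI hs)]
    exact h1 _
  have hNb : inner ℝ (N₁ s) b = 0 := by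
    obtain ⟨v, hv⟩ := (hN s hs).2.1
    rw [← hv]
    exact h1 v
  congr 1
  refine ext_inner_right ℝ fun y => ?_
  rw [hf.inner_eq_frame hs hn.self hn.pos hn.normal hn.velocity, h0, hT, hNb, inner_add_left,
    real_inner_smul_left, real_inner_smul_left]
  ring

theorem lorentz_light_add_normal (p : M) (a β : ℝ) :
    lorentz (a, a • S.pos p + β • S.n p) (a, a • S.pos p + β • S.n p) = β ^ 2 := by
  have h : inner ℝ (S.n p) (S.pos p) = 0 := by rw [real_inner_comm, S.n_tangent_sphere]
  simp only [lorentz, inner_add_left, inner_add_right, real_inner_smul_left, real_inner_smul_right,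
    S.inner_pos_pos, S.inner_n_n, S.n_tangent_sphere, h]
  ring

theorem isTangentAt_light_add_normal (p : M) (a β : ℝ) :
    S.IsTangentAt p (a, a • S.pos p + β • S.n p) := by
  have h : inner ℝ (S.n p) (S.pos p) = 0 := by rw [real_inner_comm, S.n_tangent_sphere]
  refine ⟨⟨S.norm_pos p, ?_⟩, fun v => ?_⟩
  · simp only [lorentz, light, inner_add_left, real_inner_smul_left, S.inner_pos_pos, h]
    ring
  · simp only [lorentz, inner_add_left, real_inner_smul_left, S.inner_pos_dpos, S.inner_n_dpos]
    ring

theorem isDarboux_iff (hc : S.IsUnitSpeed c I) (hI : IsOpen I) {N₁ : ℝ → E4}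
    (hN : S.IsUnitConormal c I N₁) : S.IsDarboux c I ↔
      ∀ s ∈ I, deriv (S.normalCurv c) s + S.geodTorsion c N₁ s * S.geodCurv c N₁ s = 0 := by
  have hf := hc.unitNormalCurve hI
  refine forall₂_congr fun s hs => ?_
  rw [deriv_normalCurv_add hc hI hN hs]
  constructor
  · rintro ⟨σ, ⟨hΛ, hσ⟩, ht⟩
    obtain ⟨a, β, rfl⟩ := ht.exists_eq hc hI hN hs
    -- For β = 0 the vector would be a multiple of m, of Lorentz square 0 instead of 1.
    have hβ : β ≠ 0 := by
      rintro rfl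
      have h1 := (lorentz_light_add_normal (S := S) (c s) a 0).symm.trans hΛ
      norm_num at h1
    exact ((hf.hasContact_three_iff hs hβ).1 hσ).2
  · intro h0
    refine ⟨(1 * S.normalCurv c s, (1 * S.normalCurv c s) • (S.pos ∘ c) s + (1 : ℝ) • (S.n ∘ c) s),
      ⟨?_, (hf.hasContact_three_iff hs one_ne_zero).2 ⟨rfl, h0⟩⟩,
      isTangentAt_light_add_normal _ _ _⟩
    exact (lorentz_light_add_normal (S := S) (c s) _ 1).trans (one_pow 2)

/-! ### Geodesics of V(M) -/

/-- If the N-component of ν' vanished, only -k_n T would remain, and the velocity would be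
principal. -/
theorem geodTorsion_ne_zero (hc : S.IsUnitSpeed c I) (hI : IsOpen I) {N : E4}
    (hn : ConormalAt S c s N) (hs : s ∈ S.nonPrincipal c I) :
    inner ℝ N (deriv (S.n ∘ c) s) ≠ 0 := by
  intro h0
  have hf := hc.unitNormalCurve hI
  have hcs := hc.mdifferentiableAt hI hs.1
  refine hs.2 ⟨S.normalCurv c s, fun hv => ?_, ?_⟩
  · have := hc.2 s hs.1
    rw [S.deriv_pos_comp hcs, hv, map_zero] at this
    simp at this
  · rw [← S.deriv_pos_comp hcs, ← S.deriv_n_comp hcs]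
    refine ext_inner_right ℝ fun y => ?_
    rw [hf.inner_eq_frame hs.1 hn.self hn.pos hn.normal hn.velocity,
      hf.inner_self_deriv_normal hs.1, hf.inner_normal_deriv_normal hs.1,
      hf.inner_deriv_deriv_normal hs.1, h0, real_inner_smul_left]
    change _ = -curvAlong (S.pos ∘ c) (S.n ∘ c) s * _
    ring

/-- The polarization of `II - k I` along a line. -/
theorem secondForm_add_smul (p : M) (k : ℝ) (v w : TangentSpace (𝓡 2) p) (t : ℝ) :
    S.secondForm p (v + t • w) - k * S.firstForm p (v + t • w) =
      (S.secondForm p v - k * S.firstForm p v) +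
      2 * t * (-inner ℝ (S.dn p v) (S.dpos p w) - k * inner ℝ (S.dpos p v) (S.dpos p w)) +
      t ^ 2 * (S.secondForm p w - k * S.firstForm p w) := by
  simp only [secondForm, firstForm, map_add, map_smul, inner_add_left, inner_add_right,
    real_inner_smul_left, real_inner_smul_right]
  rw [S.inner_dn_dpos_comm p w v, real_inner_comm (S.dpos p v) (S.dpos p w)]
  ring

/-- The form II - k_n I vanishes on T and has mixed term ±τ_g ≠ 0 with N, so it is indefinite. -/
theorem saddleContact_of_nonPrincipal (hc : S.IsUnitSpeed c I) (hI : IsOpen I) {N₁ : ℝ → E4}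
    (hN : S.IsUnitConormal c I N₁) (hs : s ∈ S.nonPrincipal c I) :
    S.SaddleContact (c s) (S.normalCurv c s) := by
  have hf := hc.unitNormalCurve hI
  have hn := hN.conormalAt hs.1
  have hcs := hc.mdifferentiableAt hI hs.1
  have hτ := geodTorsion_ne_zero hc hI hn hs
  obtain ⟨w, hw⟩ := (hN s hs.1).2.1
  set v := velocity c s
  set k := S.normalCurv c s with hk
  set τ := inner ℝ (N₁ s) (deriv (S.n ∘ c) s) with hτd
  set D := S.secondForm (c s) w - k * S.firstForm (c s) w with hD
  have h0 : S.secondForm (c s) v - k * S.firstForm (c s) v = 0 := by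
    rw [secondForm, firstForm, ← S.deriv_pos_comp hcs, ← S.deriv_n_comp hcs, real_inner_comm,
      hf.inner_deriv_deriv_normal hs.1, hf.deriv_self s hs.1]
    change - -S.normalCurv c s - S.normalCurv c s * 1 = 0
    ring
  have h1 : -inner ℝ (S.dn (c s) v) (S.dpos (c s) w) -
      k * inner ℝ (S.dpos (c s) v) (S.dpos (c s) w) = -τ := by
    rw [hw, ← S.deriv_pos_comp hcs, ← S.deriv_n_comp hcs, hn.velocity, real_inner_comm]
    ring
  have hq : ∀ t : ℝ, S.secondForm (c s) (v + t • w) - k * S.firstForm (c s) (v + t • w) =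
      t * (-(2 * τ) + t * D) := by
    intro t
    rw [secondForm_add_smul, h0, h1]
    ring
  have hd : 0 < 1 + |D| := by positivity
  have hsq : 0 < τ ^ 2 / (1 + |D|) := by positivity
  have habs : |D / (1 + |D|)| < 1 := by
    rw [abs_div, abs_of_pos hd, div_lt_one hd]
    linarith
  rw [abs_lt] at habs
  -- On v + t w the form is t(-2τ + tD). Taking |t| = |τ|/(1 + |D|) keeps |tD| below |τ|, so the
  -- linear term decides the sign.
  refine ⟨v + (τ / (1 + |D|)) • w, v + (-τ / (1 + |D|)) • w, ?_, ?_⟩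
  · rw [hq]
    have : τ / (1 + |D|) * (-(2 * τ) + τ / (1 + |D|) * D) =
        τ ^ 2 / (1 + |D|) * (-2 + D / (1 + |D|)) := by
      field_simp
    rw [this]
    exact mul_neg_of_pos_of_neg hsq (by linarith)
  · rw [hq]
    have : -τ / (1 + |D|) * (-(2 * τ) + -τ / (1 + |D|) * D) =
        τ ^ 2 / (1 + |D|) * (2 + D / (1 + |D|)) := by
      field_simp
      ring
    rw [this]
    exact mul_pos hsq (by linarith)

theorem mem_tangentV_iff (p : M) (k : ℝ) (w : L5) : w ∈ S.tangentV (p, k) ↔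
    ∃ (v : TangentSpace (𝓡 2) p) (κ : ℝ),
      w = (κ, κ • S.pos p + (k • S.dpos p v + S.dn p v)) := by
  refine exists_congr fun v => exists_congr fun κ => ?_
  have : κ • light (S.pos p) + k • ((0 : ℝ), S.dpos p v) + ((0 : ℝ), S.dn p v) =
      (κ, κ • S.pos p + (k • S.dpos p v + S.dn p v)) := by
    ext1
    · simp [light]
    · simp [light, add_assoc]
  rw [← this]

theorem isGeodesicInV_iff (hc : S.IsUnitSpeed c I) (hI : IsOpen I) {N₁ : ℝ → E4}
    (hN : S.IsUnitConormal c I N₁) {k : ℝ → ℝ} (hk : ∀ s ∈ I, k s = S.normalCurv c s) :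
    IsGeodesicInV S (fun s => (c s, k s)) (S.nonPrincipal c I) ↔
      ∀ s ∈ S.nonPrincipal c I,
        deriv (S.normalCurv c) s + S.geodTorsion c N₁ s * S.geodCurv c N₁ s = 0 := by
  have hf := hc.unitNormalCurve hI
  refine forall₂_congr fun s hs => ?_
  have hn := hN.conormalAt hs.1
  have hcs := hc.mdifferentiableAt hI hs.1
  have hτ := geodTorsion_ne_zero hc hI hn hs
  have hσ : S.tangentSphere ∘ (fun s => (c s, k s)) =ᶠ[𝓝 s]
      sphereAlong (S.pos ∘ c) (S.n ∘ c) := by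
    refine eventually_of_forall_mem hI hs.1 fun t ht => ?_
    have : k t = curvAlong (S.pos ∘ c) (S.n ∘ c) t := hk t ht
    simp [tangentSphere, sphereAlong, light, this]
  have hexpr : deriv (curvAlong (S.pos ∘ c) (S.n ∘ c)) s -
      inner ℝ (N₁ s) (deriv (deriv (S.pos ∘ c)) s) * inner ℝ (N₁ s) (deriv (S.n ∘ c) s) =
      deriv (S.normalCurv c) s + S.geodTorsion c N₁ s * S.geodCurv c N₁ s := by
    rw [geodTorsion, geodCurv, real_inner_comm (N₁ s) (deriv (S.n ∘ c) s),
      real_inner_comm (N₁ s) (deriv (deriv (S.pos ∘ c)) s)]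
    change deriv (S.normalCurv c) s - _ = _
    ring
  have hgeod : ∀ (v : TangentSpace (𝓡 2) (c s)) (κ : ℝ),
      lorentz (geodCurvVector (S.tangentSphere ∘ (fun s => (c s, k s))) s)
        (κ, κ • S.pos (c s) + (k s • S.dpos (c s) v + S.dn (c s) v)) =
      (inner ℝ (N₁ s) (deriv (S.n ∘ c) s) ^ 2)⁻¹ *
        (inner ℝ (deriv (S.pos ∘ c) s) (k s • S.dpos (c s) v + S.dn (c s) v) *
        (deriv (S.normalCurv c) s + S.geodTorsion c N₁ s * S.geodCurv c N₁ s)) := by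
    intro v κ
    rw [← hexpr]
    refine hf.lorentz_geodCurvVector_of_eventuallyEq hs.1 hn.self hn.pos hn.normal hn.velocity hτ hσ
      ?_ ?_
    · rw [inner_add_right, real_inner_smul_right]
      simp only [Function.comp_apply]
      rw [S.inner_pos_dpos, S.inner_pos_dn]
      ring
    · rw [inner_add_right, real_inner_smul_right]
      simp only [Function.comp_apply]
      rw [S.inner_n_dpos, S.inner_n_dn]
      ring
  constructor
  · rintro ⟨-, -, hg⟩
    obtain ⟨w, hw⟩ := (hN s hs.1).2.1
    -- The test vector has dm(w) = N and κ = 0. By symmetry of the shape operator its T-component is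
    -- ⟨N, ν'⟩ ≠ 0, so the Darboux factor must vanish.
    have h0 := hg _ ((mem_tangentV_iff (S := S) (c s) (k s) _).2 ⟨w, 0, rfl⟩)
    have hx : inner ℝ (deriv (S.pos ∘ c) s) (k s • S.dpos (c s) w + S.dn (c s) w) =
        inner ℝ (N₁ s) (deriv (S.n ∘ c) s) := by
      rw [inner_add_right, real_inner_smul_right, hw, hn.velocity, S.deriv_pos_comp hcs,
        real_inner_comm, S.inner_dn_dpos_comm, hw, S.deriv_n_comp hcs, real_inner_comm]
      ring
    rw [hgeod, hx] at h0
    have h1 := (mul_eq_zero.1 h0).resolve_left (inv_ne_zero (pow_ne_zero 2 hτ))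
    exact (mul_eq_zero.1 h1).resolve_left hτ
  · intro h0
    refine ⟨Or.inl ?_, ?_, fun w hw => ?_⟩
    · change S.SaddleContact (c s) (k s)
      rw [hk s hs.1]
      exact saddleContact_of_nonPrincipal hc hI hN hs
    · rw [hσ.deriv_eq,
        (hf.lorentz_deriv_sphereAlong_self hs.1 hn.self hn.pos hn.normal hn.velocity).1]
      positivity
    · obtain ⟨v, κ, rfl⟩ := (mem_tangentV_iff (S := S) (c s) (k s) _).1 hw
      rw [hgeod, h0]
      ring

/-- A pointwise condition on the Darboux expression extends from a dense set of parameters. -/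
theorem forall_mem_of_forall_nonPrincipal (hc : S.IsUnitSpeed c I) (hI : IsOpen I) {N₁ : ℝ → E4}
    (hN : S.IsUnitConormal c I N₁) (hdense : I ⊆ closure (S.nonPrincipal c I))
    (h : ∀ s ∈ S.nonPrincipal c I,
      deriv (S.normalCurv c) s + S.geodTorsion c N₁ s * S.geodCurv c N₁ s = 0) :
    ∀ s ∈ I, deriv (S.normalCurv c) s + S.geodTorsion c N₁ s * S.geodCurv c N₁ s = 0 := by
  have hf := hc.unitNormalCurve hI
  intro s hs
  -- N₁ need not be continuous, so continuity is taken from ⟨γ''', ν⟩ instead of from τ_g and k_g.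
  rw [deriv_normalCurv_add hc hI hN hs]
  have hcont : ContinuousOn
      (fun t => inner ℝ (deriv (deriv (deriv (S.pos ∘ c))) t) ((S.n ∘ c) t)) I :=
    ((contDiffOn_deriv hI (contDiffOn_deriv hI (contDiffOn_deriv hI hf.smooth))).inner ℝ
      hf.smooth_normal).continuousOn
  have heq : Set.EqOn (fun t => inner ℝ (deriv (deriv (deriv (S.pos ∘ c))) t) ((S.n ∘ c) t))
      (fun _ => (0 : ℝ)) (S.nonPrincipal c I) := by
    intro t ht
    have := h t ht
    rwa [deriv_normalCurv_add hc hI hN ht.1] at this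
  exact heq.of_subset_closure hcont continuousOn_const (fun t ht => ht.1) hdense hs

end Surface

end DarbouxCurves

end

theorem theorem10 {M : Type*} [TopologicalSpace M]
    [ChartedSpace (EuclideanSpace ℝ (Fin 2)) M] [IsManifold (𝓡 2) ∞ M]
    (S : DarbouxCurves.Surface M) (I : Set ℝ) (hI : IsOpen I) (hconn : I.OrdConnected)
    (c : ℝ → M) (hc : S.IsUnitSpeed c I)
    (N₁ : ℝ → DarbouxCurves.E4) (hN : S.IsUnitConormal c I N₁) :
    (S.IsDarboux c I ↔
      ∀ s ∈ I, deriv (S.normalCurv c) s + S.geodTorsion c N₁ s * S.geodCurv c N₁ s = 0) ∧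
    (I ⊆ closure (S.nonPrincipal c I) →
      ∀ k : ℝ → ℝ, S.IsCansec c I k →
        (S.IsDarboux c I ↔
          DarbouxCurves.IsGeodesicInV S (fun s => (c s, k s)) (S.nonPrincipal c I)) ∧
        (DarbouxCurves.IsGeodesicInV S (fun s => (c s, k s)) (S.nonPrincipal c I) ↔
          ∀ s ∈ I, deriv (S.normalCurv c) s +
            S.geodTorsion c N₁ s * S.geodCurv c N₁ s = 0)) := by
  have hD := DarbouxCurves.Surface.isDarboux_iff hc hI hN
  refine ⟨hD, fun hdense k hk => ?_⟩
  have hG : DarbouxCurves.IsGeodesicInV S (fun s => (c s, k s)) (S.nonPrincipal c I) ↔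
      ∀ s ∈ I, deriv (S.normalCurv c) s + S.geodTorsion c N₁ s * S.geodCurv c N₁ s = 0 := by
    rw [DarbouxCurves.Surface.isGeodesicInV_iff hc hI hN fun s hs => hk.eq_normalCurv hc hI hs]
    exact ⟨DarbouxCurves.Surface.forall_mem_of_forall_nonPrincipal hc hI hN hdense,
      fun h s hs => h s hs.1⟩
  exact ⟨hD.trans hG.symm, hG⟩
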